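/- Let $K\subset\mathbb C\cong\mathbb R^2$ be a convex body (a non-empty compact convex set), with $\langle x,u\rangle=\operatorname{Re}(\bar x u)$. A unit vector $u$ is an inner unit normal vector of $K$ at $x\in K$ if $\langle y-x,u\rangle\ge 0$ for all $y\in K$. Let $\operatorname{reg}(K)$ be the set of boundary points of $K$ at which there is exactly one inner unit normal vector, denoted $u_K(x)$ (so $u_K:\operatorname{reg}(K)\to S^1$ is the Gauss map), and let $\operatorname{reg-exp}(K)$ be the set of those $x\in\operatorname{reg}(K)$ that are exposed points of $K$. If $u\in S^1$ is such that $x\mapsto\langle x,u\rangle$ has a unique minimizer on $K$, this minimizer is denoted $x_K(u)$ (the reverse Gauss map). Let $h_K(\theta)=\min_{x\in K}\langle x,e^{i\theta}\rangle$ for $\theta\in\mathbb R$. For $z\in\operatorname{reg}(K)$, take cartesian coordinates $(\xi,\eta)$ with origin $z$ and orthonormal basis $(-i\,u_K(z),u_K(z))$. Then $K$ lies in $\{\eta\ge 0\}$ and $\partial K$ is near $z$ the graph $\eta=f(\xi)$ of the convex function $f(\xi)=\min\{\eta:(\xi,\eta)\in K\}$. If $\kappa(z)=\lim_{\xi\to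 0,\ \xi\ne 0}2f(\xi)/\xi^2$ exists in $[0,+\infty]$, then $\rho(z)=1/\kappa(z)\in[0,+\infty]$ is called the radius of curvature of $\partial K$ at $z$. A set $M\subset\mathbb C$ is a $C^k$-submanifold (of dimension one) if every $p\in M$ has an open neighbourhood $U$ in $\mathbb C$ with a real $C^k$-diffeomorphism $g:U\to V$ onto an open neighbourhood $V$ of $g(p)=0$ in $\mathbb R^2$ such that $g(M\cap U)=V\cap(\mathbb R\times\{0\})$. It is so locally at $z$ if $M\cap U_0$ is a $C^k$-submanifold for some open $U_0\ni z$. A map on a subset of $\mathbb C$ is of class $C^m$ if it is locally the restriction of a real $C^m$-map defined on an open subset of $\mathbb C$. A bijection of class $C^m$ with inverse of class $C^m$ is called a $C^m$-diffeomorphism. **Theorem.** Let $k\ge 2$ be an integer, let $z\in\operatorname{reg-exp}(K)$, and let $\theta\in\mathbb R$ be such that $e^{i\theta}=u_K(x)$ for some $x\in\operatorname{reg-exp}(K)$, and $z=x_K(e^{i\theta})$. Then the following are equivalent. (a) $\operatorname{reg-exp}(K)$ is locally at $z$ a $C^k$-submanifold of $\mathbb C$, and $u_K$ is locally at $z$ a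 $C^{k-1}$-diffeomorphism, that is, it restricts to a $C^{k-1}$-diffeomorphism from an open neighbourhood of $z$ in $\operatorname{reg-exp}(K)$ onto an open neighbourhood of $u_K(z)$ in $S^1$. (b) $h_K$ is of class $C^k$ in a neighbourhood of $\theta$, and the radius of curvature $\rho(z)$ of $\partial K$ at $z$ exists and satisfies $0<\rho(z)<+\infty$. -/

import Mathlib

open Filter Topology
open scoped ENNReal

noncomputable section

namespace PlanarConvex

/-- `u` is an inner unit normal vector of `K` at `x`. -/
def IsInnerUnitNormal (K : Set ℂ) (x u : ℂ) : Prop :=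
  ‖u‖ = 1 ∧ ∀ y ∈ K, 0 ≤ inner ℝ (y - x) u

/-- `reg(K)`: the boundary points of `K` with exactly one inner unit normal vector. -/
def reg (K : Set ℂ) : Set ℂ :=
  {x | x ∈ K ∧ x ∈ frontier K ∧ ∃! u : ℂ, IsInnerUnitNormal K x u}

/-- `reg-exp(K)`: the regular exposed points of `K`. -/
def regExp (K : Set ℂ) : Set ℂ :=
  reg K ∩ K.exposedPoints ℝ

open Classical in
/-- The Gauss map `u_K` on `reg(K)`, sending a regular boundary point to its inner unit normal
vector (extended by `0` outside `reg(K)`). -/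
def gaussMap (K : Set ℂ) (x : ℂ) : ℂ :=
  if h : ∃! u : ℂ, IsInnerUnitNormal K x u then h.choose else 0

/-- The exposed face `F_K(u)`: the set of minimizers of `⟨x, u⟩` over `x ∈ K`. -/
def exposedFace (K : Set ℂ) (u : ℂ) : Set ℂ :=
  {x | x ∈ K ∧ ∀ y ∈ K, inner ℝ x u ≤ inner ℝ y u}

open Classical in
/-- The reverse Gauss map `x_K`, sending a unit vector `u` whose exposed face `F_K(u)` is a
singleton to the unique point of `F_K(u)` (extended by `0` to all other vectors). -/
def reverseGaussMap (K : Set ℂ) (u : ℂ) : ℂ :=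
  if h : ∃ x : ℂ, exposedFace K u = {x} then h.choose else 0

/-- `un-regn(K)`: the inner unit normal vectors at regular exposed points. -/
def unRegn (K : Set ℂ) : Set ℂ :=
  gaussMap K '' regExp K

/-- `Ξ_K^R`: the angular representation of `un-regn(K)`. -/
def regularAngles (K : Set ℂ) : Set ℝ :=
  {θ | Complex.exp (θ * Complex.I) ∈ unRegn K}

/-- The support function `u ↦ min_{x ∈ K} ⟨x, u⟩`. -/
def supportFun (K : Set ℂ) (u : ℂ) : ℝ :=
  sInf ((fun x : ℂ => (inner ℝ x u : ℝ)) '' K)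

/-- The support function in angular coordinates, `h_K(θ)`. -/
def supportAngle (K : Set ℂ) (θ : ℝ) : ℝ :=
  supportFun K (Complex.exp (θ * Complex.I))

/-- The function `f` whose graph is `∂K` near the regular boundary point `z`, in the positively
oriented cartesian coordinates `(ξ, η)` with origin `z` and orthonormal basis `(-i u, u)`, where
`u = u_K(z)` (so that `K` lies in the half-plane `η ≥ 0`). -/
def boundaryGraph (K : Set ℂ) (z : ℂ) (ξ : ℝ) : ℝ :=
  sInf {η : ℝ | z + ξ • (-Complex.I * gaussMap K z) + η • gaussMap K z ∈ K}

/-- The upper curvature of `∂K` at `z`. (Near `0` the function `boundaryGraph K z` is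
nonnegative, so `ENNReal.ofReal` is only an embedding.) -/
def upperCurvature (K : Set ℂ) (z : ℂ) : ℝ≥0∞ :=
  limsup (fun ξ : ℝ => ENNReal.ofReal (2 * boundaryGraph K z ξ / ξ ^ 2)) (𝓝[≠] 0)

/-- The lower curvature of `∂K` at `z`. -/
def lowerCurvature (K : Set ℂ) (z : ℂ) : ℝ≥0∞ :=
  liminf (fun ξ : ℝ => ENNReal.ofReal (2 * boundaryGraph K z ξ / ξ ^ 2)) (𝓝[≠] 0)

/-- The curvature of `∂K` at `z` exists in `[0, ∞]` and `ρ ∈ [0, ∞]` is its inverse, the radius of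
curvature. -/
def HasRadiusOfCurvature (K : Set ℂ) (z : ℂ) (ρ : ℝ≥0∞) : Prop :=
  upperCurvature K z = lowerCurvature K z ∧ ρ = (upperCurvature K z)⁻¹

/-- `M` is a (one-dimensional) `C^k`-submanifold of `ℂ`: every point of `M` has an open
neighbourhood `U` in `ℂ` and a `C^k`-diffeomorphism `g` of `U` onto an open neighbourhood `V` of
`0` in the plane, taking `M ∩ U` to the part of the first axis in `V`. -/
def IsSubmanifold (k : ℕ) (M : Set ℂ) : Prop :=
  ∀ p ∈ M, ∃ g : OpenPartialHomeomorph ℂ (ℝ × ℝ), p ∈ g.source ∧ g p = 0 ∧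
    ContDiffOn ℝ k g g.source ∧ ContDiffOn ℝ k g.symm g.target ∧
    g '' (M ∩ g.source) = {y | y.2 = 0} ∩ g.target

/-- `M` is locally at `z` a `C^k`-submanifold of `ℂ`. -/
def IsSubmanifoldAt (k : ℕ) (M : Set ℂ) (z : ℂ) : Prop :=
  ∃ U : Set ℂ, IsOpen U ∧ z ∈ U ∧ IsSubmanifold k (M ∩ U)

/-- `f` is of class `C^m` on the subset (submanifold) `M` of `ℂ`: around each point of `M` it is
the restriction to `M` of a (real) `C^m`-map defined on an open subset of `ℂ`. -/
def IsClassOn (m : ℕ) (f : ℂ → ℂ) (M : Set ℂ) : Prop :=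
  ∀ x ∈ M, ∃ F : ℂ → ℂ, ContDiffAt ℝ m F x ∧ f =ᶠ[𝓝[M] x] F

/-- `f` restricts to a `C^m`-diffeomorphism from `M` onto `N`. -/
def IsDiffeoOn (m : ℕ) (f : ℂ → ℂ) (M N : Set ℂ) : Prop :=
  Set.MapsTo f M N ∧ IsClassOn m f M ∧
    ∃ g : ℂ → ℂ, Set.MapsTo g N M ∧ Set.InvOn g f M N ∧ IsClassOn m g N

/-- `f` is locally at `z` a `C^m`-diffeomorphism from `M` to `N`: it restricts to a
`C^m`-diffeomorphism from an open neighbourhood of `z` in `M` onto an open neighbourhood of `f z`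
in `N`. -/
def IsDiffeoAt (m : ℕ) (f : ℂ → ℂ) (M N : Set ℂ) (z : ℂ) : Prop :=
  ∃ U W : Set ℂ, IsOpen U ∧ IsOpen W ∧ z ∈ U ∧ f z ∈ W ∧ IsDiffeoOn m f (M ∩ U) (N ∩ W)

end PlanarConvex

end

/-!
The statement is proved through the curve of support points. Since `z` is exposed and regular,
`u_K(z) = e^{iθ}`, and `z` is recovered from its normal (`exposedFace_gaussMap`). Let `X(φ)` denote
the support point of `K` with inner normal `e^{iφ}`, for `φ` near `θ`, so that `X(θ) = z` and
`h_K(φ) = ⟨X(φ), e^{iφ}⟩`. Minimality of `X(φ)` makes `X'(φ)` orthogonal to `e^{iφ}`, whence the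
envelope formula `h_K'(φ) = ⟨X(φ), i e^{iφ}⟩` (`hasDerivAt_supportAngle`): the support function has
exactly one derivative more than `X`. The link to the curvature is the speed
`r = ⟨X'(θ), -i e^{iθ}⟩`, for which
`h_K(φ) - ⟨z, e^{iφ}⟩ = -r (φ - θ)² / 2 + o((φ - θ)²)` (`tendsto_supportAngle_div_sq`).

If the Gauss map is a local `C^{k-1}`-diffeomorphism, then `X` is its inverse composed with the
exponential, hence of class `C^{k-1}` with nonzero velocity
(`exists_supportCurve_of_isDiffeoAt`), and `h_K` is of class `C^k`. In tangential and normal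
coordinates at `z` the curve satisfies `ξ ~ r (φ - θ)` and `η ~ r (φ - θ)² / 2`, and `∂K` is its
trace, so the curvature is `1 / r` (`tendsto_boundaryGraph`).

Conversely, let `h_K` be of class `C^k`. Every support point is determined by `h_K` and `h_K'`, so
`X` exists and is of class `C^{k-1}` (`exists_supportCurve_of_contDiffAt`). Finite curvature puts
points of `K` below a parabola touching the tangent at `z`, and testing `h_K` at these points gives
`r > 0` (`tau_deriv_pos`). Hence `φ ↦ ξ(X(φ))` is a local diffeomorphism; a normal of `K` at `X(φ)`
is orthogonal to `X'(φ) ≠ 0`, so that `X(φ)` is a regular exposed point (`supportPoint_mem_regExp`);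
and by compactness every regular exposed point close to `z` arises in this way
(`exists_isGraphChart`). The Gauss map and its inverse are then read off in the parameter `φ`. The
set of regular exposed points is locally the graph of a function whose slope is the tangent of
`φ - θ`, so the function is of class `C^k` (`IsGraphChart.contDiffAt_graph`) although the
parametrization is only of class `C^{k-1}`.
-/

namespace PlanarConvex

/-! ### Rotating coordinates -/

/-- The unit vector `e^{iφ}`. -/
noncomputable def dir (φ : ℝ) : ℂ := Complex.exp (φ * Complex.I)

/-- The coordinate `p ↦ ⟨p, e^{iφ}⟩`. -/
noncomputable def nu (φ : ℝ) : ℂ →L[ℝ] ℝ := Real.cos φ • Complex.reCLM + Real.sin φ • Complex.imCLM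

/-- The coordinate `p ↦ ⟨p, -i e^{iφ}⟩`. -/
noncomputable def tau (φ : ℝ) : ℂ →L[ℝ] ℝ := Real.sin φ • Complex.reCLM - Real.cos φ • Complex.imCLM

lemma nu_apply (φ : ℝ) (p : ℂ) : nu φ p = Real.cos φ * p.re + Real.sin φ * p.im := by
  simp [nu]

lemma tau_apply (φ : ℝ) (p : ℂ) : tau φ p = Real.sin φ * p.re - Real.cos φ * p.im := by
  simp [tau]

lemma dir_re (φ : ℝ) : (dir φ).re = Real.cos φ := Complex.exp_ofReal_mul_I_re φ

lemma dir_im (φ : ℝ) : (dir φ).im = Real.sin φ := Complex.exp_ofReal_mul_I_im φ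

lemma norm_dir (φ : ℝ) : ‖dir φ‖ = 1 := Complex.norm_exp_ofReal_mul_I φ

lemma dir_ne_zero (φ : ℝ) : dir φ ≠ 0 := Complex.exp_ne_zero _

lemma inner_eq (p q : ℂ) : inner ℝ p q = p.re * q.re + p.im * q.im := by
  simp [Complex.inner]; ring

lemma inner_dir (φ : ℝ) (p : ℂ) : inner ℝ p (dir φ) = nu φ p := by
  rw [inner_eq, nu_apply, dir_re, dir_im]; ring

lemma inner_neg_I_mul_dir (φ : ℝ) (p : ℂ) : inner ℝ p (-Complex.I * dir φ) = tau φ p := by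
  rw [inner_eq, tau_apply]; simp [dir_re, dir_im]; ring

/-- The point with origin `z` and coordinates `ξ`, `η` along `-i e^{iθ}` and `e^{iθ}`. -/
noncomputable def ofCoords (θ : ℝ) (z : ℂ) (ξ η : ℝ) : ℂ :=
  z + ξ • (-Complex.I * dir θ) + η • dir θ

lemma ofCoords_re (θ : ℝ) (z : ℂ) (ξ η : ℝ) :
    (ofCoords θ z ξ η).re = z.re + ξ * Real.sin θ + η * Real.cos θ := by
  simp [ofCoords, dir_re, dir_im]

lemma ofCoords_im (θ : ℝ) (z : ℂ) (ξ η : ℝ) :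
    (ofCoords θ z ξ η).im = z.im - ξ * Real.cos θ + η * Real.sin θ := by
  simp [ofCoords, dir_re, dir_im]; ring

lemma ofCoords_coords (θ : ℝ) (z p : ℂ) : ofCoords θ z (tau θ (p - z)) (nu θ (p - z)) = p := by
  have h := Real.sin_sq_add_cos_sq θ
  apply Complex.ext
  · rw [ofCoords_re, tau_apply, nu_apply, Complex.sub_re, Complex.sub_im]
    linear_combination (p.re - z.re) * h
  · rw [ofCoords_im, tau_apply, nu_apply, Complex.sub_re, Complex.sub_im]
    linear_combination (p.im - z.im) * h

lemma tau_ofCoords (θ : ℝ) (z : ℂ) (ξ η : ℝ) : tau θ (ofCoords θ z ξ η - z) = ξ := by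
  rw [tau_apply, Complex.sub_re, Complex.sub_im, ofCoords_re, ofCoords_im]
  linear_combination ξ * Real.sin_sq_add_cos_sq θ

lemma nu_ofCoords (θ : ℝ) (z : ℂ) (ξ η : ℝ) : nu θ (ofCoords θ z ξ η - z) = η := by
  rw [nu_apply, Complex.sub_re, Complex.sub_im, ofCoords_re, ofCoords_im]
  linear_combination η * Real.sin_sq_add_cos_sq θ

lemma eq_of_coords_eq {θ : ℝ} {z p q : ℂ} (h₁ : tau θ (p - z) = tau θ (q - z))
    (h₂ : nu θ (p - z) = nu θ (q - z)) : p = q := by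
  rw [← ofCoords_coords θ z p, h₁, h₂, ofCoords_coords]

lemma nu_rotate (θ φ : ℝ) (p : ℂ) :
    nu φ p = nu θ p * Real.cos (φ - θ) - tau θ p * Real.sin (φ - θ) := by
  simp only [nu_apply, tau_apply, Real.cos_sub, Real.sin_sub]
  linear_combination (-(Real.cos φ * p.re + Real.sin φ * p.im)) * Real.sin_sq_add_cos_sq θ

lemma contDiff_dir {n : WithTop ℕ∞} : ContDiff ℝ n dir := by
  have : ContDiff ℝ n (fun φ : ℝ => ((φ : ℂ) * Complex.I)) :=
    Complex.ofRealCLM.contDiff.mul contDiff_const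
  exact this.cexp

lemma hasDerivAt_dir (φ : ℝ) : HasDerivAt dir (Complex.I * dir φ) φ := by
  have h := ((hasDerivAt_id (φ : ℝ)).ofReal_comp.mul_const Complex.I).cexp
  change HasDerivAt (fun φ : ℝ => Complex.exp (φ * Complex.I)) _ φ
  simpa [dir, mul_comm Complex.I] using h

lemma _root_.HasDerivAt.nu_comp {X : ℝ → ℂ} {X' : ℂ} {φ : ℝ} (hX : HasDerivAt X X' φ) (θ : ℝ) :
    HasDerivAt (fun t => nu θ (X t)) (nu θ X') φ :=
  (nu θ).hasFDerivAt.comp_hasDerivAt φ hX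

lemma _root_.HasDerivAt.tau_comp {X : ℝ → ℂ} {X' : ℂ} {φ : ℝ} (hX : HasDerivAt X X' φ) (θ : ℝ) :
    HasDerivAt (fun t => tau θ (X t)) (tau θ X') φ :=
  (tau θ).hasFDerivAt.comp_hasDerivAt φ hX

lemma hasDerivAt_nu_moving {X : ℝ → ℂ} {X' : ℂ} {φ : ℝ} (hX : HasDerivAt X X' φ) :
    HasDerivAt (fun t => nu t (X t)) (nu φ X' - tau φ (X φ)) φ := by
  have hre : HasDerivAt (fun t => (X t).re) X'.re φ :=
    Complex.reCLM.hasFDerivAt.comp_hasDerivAt φ hX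
  have him : HasDerivAt (fun t => (X t).im) X'.im φ :=
    Complex.imCLM.hasFDerivAt.comp_hasDerivAt φ hX
  simp only [nu_apply]
  refine (((Real.hasDerivAt_cos φ).fun_mul hre).fun_add
    ((Real.hasDerivAt_sin φ).fun_mul him)).congr_deriv ?_
  simp only [tau_apply]
  ring

lemma hasDerivAt_tau_moving {X : ℝ → ℂ} {X' : ℂ} {φ : ℝ} (hX : HasDerivAt X X' φ) :
    HasDerivAt (fun t => tau t (X t)) (tau φ X' + nu φ (X φ)) φ := by
  have hre : HasDerivAt (fun t => (X t).re) X'.re φ :=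
    Complex.reCLM.hasFDerivAt.comp_hasDerivAt φ hX
  have him : HasDerivAt (fun t => (X t).im) X'.im φ :=
    Complex.imCLM.hasFDerivAt.comp_hasDerivAt φ hX
  simp only [tau_apply]
  refine (((Real.hasDerivAt_sin φ).fun_mul hre).fun_sub
    ((Real.hasDerivAt_cos φ).fun_mul him)).congr_deriv ?_
  simp only [nu_apply]
  ring

lemma hasDerivAt_nu_const (p : ℂ) (φ : ℝ) : HasDerivAt (fun t => nu t p) (-tau φ p) φ := by
  simpa using hasDerivAt_nu_moving (hasDerivAt_const φ p)

lemma contDiffAt_tau_moving {n : WithTop ℕ∞} {X : ℝ → ℂ} {φ : ℝ} (hX : ContDiffAt ℝ n X φ) :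
    ContDiffAt ℝ n (fun t => tau t (X t)) φ := by
  simp only [tau_apply]
  have hre : ContDiffAt ℝ n (fun t => (X t).re) φ := Complex.reCLM.contDiff.contDiffAt.comp φ hX
  have him : ContDiffAt ℝ n (fun t => (X t).im) φ := Complex.imCLM.contDiff.contDiffAt.comp φ hX
  exact (Real.contDiff_sin.contDiffAt.mul hre).sub (Real.contDiff_cos.contDiffAt.mul him)

/-- The inverse of `dir` on the unit circle with the point `-e^{iθ}` removed, with values in
`(θ - π, θ + π)`. -/
noncomputable def angle (θ : ℝ) (w : ℂ) : ℝ := θ + (w / dir θ).arg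

lemma dir_div_dir (φ θ : ℝ) : dir φ / dir θ = dir (φ - θ) := by
  rw [dir, dir, dir, ← Complex.exp_sub]; push_cast; ring_nf

lemma angle_dir {θ φ : ℝ} (h : |φ - θ| < Real.pi) : angle θ (dir φ) = φ := by
  rw [abs_lt] at h
  rw [angle, dir_div_dir, dir, Complex.arg_exp_mul_I,
    (toIocMod_eq_self Real.two_pi_pos).2 ⟨h.1, by linarith⟩]
  ring

lemma dir_angle (θ : ℝ) {w : ℂ} (hw : ‖w‖ = 1) : dir (angle θ w) = w := by
  have h := Complex.norm_mul_exp_arg_mul_I (w / dir θ)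
  rw [norm_div, hw, norm_dir, div_one, Complex.ofReal_one, one_mul] at h
  have : dir (angle θ w) = dir θ * Complex.exp ((w / dir θ).arg * Complex.I) := by
    rw [angle, dir, dir, ← Complex.exp_add]; push_cast; ring_nf
  rw [this, h, mul_div_cancel₀ _ (dir_ne_zero θ)]

lemma contDiffAt_angle {n : WithTop ℕ∞} {θ : ℝ} {w : ℂ} (hw : w / dir θ ∈ Complex.slitPlane) :
    ContDiffAt ℝ n (angle θ) w := by
  have h : ContDiffAt ℝ n (fun w : ℂ => Complex.log (w / dir θ)) w :=
    ((Complex.contDiffAt_log hw).restrict_scalars ℝ).comp w (contDiffAt_id.div_const _)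
  have h' := Complex.imCLM.contDiff.contDiffAt.comp w h
  simp only [Function.comp_def, Complex.imCLM_apply, Complex.log_im] at h'
  exact contDiffAt_const.add h'

/-! ### Calculus in one variable -/

lemma contDiffAt_succ_of_hasDerivAt {m : ℕ} {f g : ℝ → ℝ} {a : ℝ}
    (hf : ∀ᶠ t in 𝓝 a, HasDerivAt f (g t) t) (hg : ContDiffAt ℝ m g a) :
    ContDiffAt ℝ (m + 1 : ℕ) f a := by
  push_cast
  rw [contDiffAt_succ_iff_hasFDerivAt]
  refine ⟨fun t => ContinuousLinearMap.toSpanSingleton ℝ (g t),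
    ⟨_, hf, fun t ht => ht.hasFDerivAt⟩, ?_⟩
  exact (ContinuousLinearMap.toSpanSingletonCLE (𝕜 := ℝ) (E := ℝ)).contDiff.contDiffAt.comp a hg

lemma tendsto_div_sq_of_hasDerivAt {G G' : ℝ → ℝ} {a c : ℝ}
    (hG : ∀ᶠ t in 𝓝 a, HasDerivAt G (G' t) t) (h0 : G a = 0) (h1 : G' a = 0)
    (h2 : HasDerivAt G' c a) :
    Tendsto (fun t => G t / (t - a) ^ 2) (𝓝[≠] a) (𝓝 (c / 2)) := by
  have hne : ∀ᶠ t in 𝓝[≠] a, t ≠ a := eventually_mem_nhdsWithin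
  have hd : ∀ t, HasDerivAt (fun t => (t - a) ^ 2) (2 * (t - a)) t := fun t => by
    simpa using ((hasDerivAt_id t).sub_const a).fun_pow 2
  refine HasDerivAt.lhopital_zero_nhdsNE (hG.filter_mono nhdsWithin_le_nhds)
    (Eventually.of_forall hd) ?_ ?_ ?_ ?_
  · filter_upwards [hne] with t ht
    simpa [sub_eq_zero] using ht
  · have := hG.self_of_nhds.continuousAt.tendsto
    rw [h0] at this
    exact this.mono_left nhdsWithin_le_nhds
  · have := (hd a).continuousAt.tendsto
    simp only [sub_self, ne_eq, OfNat.ofNat_ne_zero, not_false_eq_true, zero_pow] at this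
    exact this.mono_left nhdsWithin_le_nhds
  · have := (hasDerivAt_iff_tendsto_slope.1 h2).div_const 2
    refine this.congr' ?_
    filter_upwards [hne] with t ht
    have : t - a ≠ 0 := sub_ne_zero.2 ht
    rw [slope_def_field, h1]
    field_simp
    ring

/-! ### Faces, normals and the support function -/

lemma supportAngle_eq {K : Set ℂ} {φ : ℝ} {x : ℂ} (hx : x ∈ exposedFace K (dir φ)) :
    supportAngle K φ = nu φ x := by
  rw [← inner_dir]
  exact IsLeast.csInf_eq ⟨⟨x, hx.1, rfl⟩, by rintro _ ⟨y, hy, rfl⟩; exact hx.2 y hy⟩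

lemma exists_mem_exposedFace {K : Set ℂ} (hK : IsCompact K) (hne : K.Nonempty) (u : ℂ) :
    (exposedFace K u).Nonempty := by
  obtain ⟨x, hx, h⟩ := hK.exists_isMinOn hne
    (f := fun x : ℂ => (inner ℝ x u : ℝ)) (by fun_prop)
  exact ⟨x, hx, fun y hy => h hy⟩

lemma supportAngle_le {K : Set ℂ} (hK : IsCompact K) {y : ℂ} (hy : y ∈ K) (φ : ℝ) :
    supportAngle K φ ≤ nu φ y := by
  obtain ⟨x, hx⟩ := exists_mem_exposedFace hK ⟨y, hy⟩ (dir φ)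
  rw [supportAngle_eq hx, ← inner_dir, ← inner_dir]
  exact hx.2 y hy

lemma isInnerUnitNormal_iff {K : Set ℂ} {x u : ℂ} (hx : x ∈ K) :
    IsInnerUnitNormal K x u ↔ ‖u‖ = 1 ∧ x ∈ exposedFace K u := by
  simp [IsInnerUnitNormal, exposedFace, hx, inner_sub_left]

lemma gaussMap_spec {K : Set ℂ} {x : ℂ} (h : ∃! u : ℂ, IsInnerUnitNormal K x u) :
    IsInnerUnitNormal K x (gaussMap K x) := by
  rw [gaussMap, dif_pos h]; exact h.choose_spec.1

lemma gaussMap_eq {K : Set ℂ} {x u : ℂ} (h : ∃! u : ℂ, IsInnerUnitNormal K x u)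
    (hu : IsInnerUnitNormal K x u) : gaussMap K x = u :=
  h.unique (gaussMap_spec h) hu

lemma not_existsUnique_normal_singleton {x : ℂ} :
    ¬ ∃! u : ℂ, IsInnerUnitNormal {x} x u := by
  intro h
  have h1 : IsInnerUnitNormal {x} x 1 := ⟨by simp, by simp⟩
  have h2 : IsInnerUnitNormal {x} x (-1) := ⟨by simp, by simp⟩
  have h3 := h.unique h1 h2
  norm_num [Complex.ext_iff] at h3

/-- At a regular exposed point, the functional that exposes it is the only normal up to scaling,
so that the point is recovered from its normal. -/
lemma exposedFace_gaussMap {K : Set ℂ} {x : ℂ} (hx : x ∈ regExp K) :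
    exposedFace K (gaussMap K x) = {x} := by
  obtain ⟨⟨hxK, -, hu⟩, -, l, hl⟩ := hx
  obtain ⟨v, hv⟩ : ∃ v : ℂ, ∀ y, l y = inner ℝ y v :=
    ⟨(InnerProductSpace.toDual ℝ ℂ).symm l, fun y => by
      rw [real_inner_comm, InnerProductSpace.toDual_symm_apply]⟩
  simp only [hv] at hl
  have hv0 : v ≠ 0 := by
    rintro rfl
    have : K = {x} := by
      refine Set.eq_singleton_iff_unique_mem.2 ⟨hxK, fun y hy => (hl y hy).2 (by simp)⟩
    rw [this] at hu
    exact not_existsUnique_normal_singleton hu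
  have hpos : 0 < ‖v‖ := norm_pos_iff.2 hv0
  have hn : IsInnerUnitNormal K x (-(‖v‖⁻¹ • v)) := by
    refine ⟨by simp [hpos.ne'], fun y hy => ?_⟩
    have := (hl y hy).1
    rw [inner_neg_right, inner_smul_right, inner_sub_left, ← mul_neg]
    have : 0 ≤ -(inner ℝ y v - inner ℝ x v : ℝ) := by linarith
    positivity
  rw [gaussMap_eq hu hn]
  refine Set.eq_singleton_iff_unique_mem.2 ⟨((isInnerUnitNormal_iff hxK).1 hn).2, fun y hy => ?_⟩
  refine (hl y hy.1).2 ?_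
  have := hy.2 x hxK
  rw [inner_neg_right, inner_smul_right, inner_neg_right, inner_smul_right, neg_le_neg_iff] at this
  exact le_of_mul_le_mul_left this (inv_pos.2 hpos)

/-- The normals of `K` depend upper semicontinuously on the point. -/
lemma eventually_normal_mem {K : Set ℂ} {z u : ℂ}
    (hu : ∀ v, IsInnerUnitNormal K z v → v = u) {V : Set ℂ} (hV : V ∈ 𝓝 u) :
    ∀ᶠ y in 𝓝 z, ∀ v, IsInnerUnitNormal K y v → v ∈ V := by
  have hS : IsCompact (Metric.sphere (0 : ℂ) 1 \ interior V) :=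
    (isCompact_sphere _ _).diff isOpen_interior
  -- The unit vectors outside `V` form a compact set, and each fails to be a normal near `z`.
  have key := hS.eventually_forall_of_forall_eventually (x₀ := z)
    (P := fun y v => ¬ IsInnerUnitNormal K y v) ?_
  · filter_upwards [key] with y hy v hv
    by_contra hvV
    exact hy v ⟨by simpa using hv.1, fun h => hvV (interior_subset h)⟩ hv
  · rintro v ⟨hv, hvV⟩
    have hnot : ¬ IsInnerUnitNormal K z v := fun h =>
      hvV (hu v h ▸ mem_interior_iff_mem_nhds.2 hV)
    simp only [IsInnerUnitNormal, not_and, not_forall, not_le] at hnot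
    obtain ⟨y, hy, hlt⟩ := hnot (by simpa using hv)
    have hc : Continuous (fun q : ℂ × ℂ => (inner ℝ (y - q.1) q.2 : ℝ)) := by fun_prop
    filter_upwards [(hc.tendsto (z, v)).eventually_lt_const hlt] with q hq h
    exact absurd (h.2 y hy) (not_le.2 hq)

/-- A differentiable curve in `K` is stationary where it minimizes a linear functional. -/
lemma inner_deriv_eq_zero {K : Set ℂ} {X : ℝ → ℂ} {X' u : ℂ} {φ : ℝ} (hX : HasDerivAt X X' φ)
    (hK : ∀ᶠ t in 𝓝 φ, X t ∈ K) (hu : X φ ∈ exposedFace K u) : (inner ℝ X' u : ℝ) = 0 := by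
  have h := hX.inner ℝ (hasDerivAt_const φ u)
  simp only [inner_zero_right, zero_add] at h
  refine IsLocalMin.hasDerivAt_eq_zero ?_ h
  filter_upwards [hK] with t ht using hu.2 _ ht

/-! ### The curve of support points -/

section SupportCurve

variable {K : Set ℂ} {X : ℝ → ℂ} {z : ℂ} {θ : ℝ}

lemma gaussMap_eq_dir (hθ : θ ∈ regularAngles K) (hzθ : z = reverseGaussMap K (dir θ)) :
    gaussMap K z = dir θ := by
  obtain ⟨x, hx, hxθ : gaussMap K x = dir θ⟩ := hθ
  have hface := exposedFace_gaussMap hx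
  rw [hxθ] at hface
  have hex : ∃ x : ℂ, exposedFace K (dir θ) = {x} := ⟨x, hface⟩
  have : z = x := by
    rw [hzθ, reverseGaussMap, dif_pos hex]
    exact Set.singleton_injective (hex.choose_spec.symm.trans hface)
  rw [this, hxθ]

lemma nu_deriv_eq_zero {X' : ℂ} {φ : ℝ} (hX : HasDerivAt X X' φ)
    (hface : ∀ᶠ t in 𝓝 φ, X t ∈ exposedFace K (dir t)) : nu φ X' = 0 := by
  rw [← inner_dir]
  exact inner_deriv_eq_zero hX (hface.mono fun t ht => ht.1) hface.self_of_nhds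

/-- The envelope formula `h_K'(φ) = ⟨X(φ), i e^{iφ}⟩`. -/
lemma hasDerivAt_supportAngle {φ : ℝ} (hX : DifferentiableAt ℝ X φ)
    (hface : ∀ᶠ t in 𝓝 φ, X t ∈ exposedFace K (dir t)) :
    HasDerivAt (supportAngle K) (-tau φ (X φ)) φ := by
  have h := hasDerivAt_nu_moving hX.hasDerivAt
  rw [nu_deriv_eq_zero hX.hasDerivAt hface, zero_sub] at h
  exact h.congr_of_eventuallyEq (hface.mono fun t ht => supportAngle_eq ht)

lemma eventually_hasDerivAt_supportAngle {m : ℕ} (hm : m ≠ 0) (hX : ContDiffAt ℝ m X θ)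
    (hface : ∀ᶠ t in 𝓝 θ, X t ∈ exposedFace K (dir t)) :
    ∀ᶠ φ in 𝓝 θ, HasDerivAt (supportAngle K) (-tau φ (X φ)) φ := by
  filter_upwards [hX.eventually (by simp), hface.eventually_nhds] with φ h1 h2
  exact hasDerivAt_supportAngle (h1.differentiableAt (by exact_mod_cast hm)) h2

/-- The support function gains one derivative over the curve of support points. -/
lemma contDiffAt_supportAngle {m : ℕ} (hm : m ≠ 0) (hX : ContDiffAt ℝ m X θ)
    (hface : ∀ᶠ t in 𝓝 θ, X t ∈ exposedFace K (dir t)) :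
    ContDiffAt ℝ (m + 1 : ℕ) (supportAngle K) θ :=
  contDiffAt_succ_of_hasDerivAt (eventually_hasDerivAt_supportAngle hm hX hface)
    (contDiffAt_tau_moving hX).neg

/-- The speed `⟨X'(θ), -i e^{iθ}⟩` of the curve of support points is minus twice the second-order
coefficient of the support function relative to the point `X(θ)`. -/
lemma tendsto_supportAngle_div_sq {X' : ℂ}
    (hh : ∀ᶠ φ in 𝓝 θ, HasDerivAt (supportAngle K) (-tau φ (X φ)) φ)
    (hX : HasDerivAt X X' θ) (h0 : X θ ∈ exposedFace K (dir θ)) :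
    Tendsto (fun φ => (supportAngle K φ - nu φ (X θ)) / (φ - θ) ^ 2) (𝓝[≠] θ)
      (𝓝 (-tau θ X' / 2)) := by
  refine tendsto_div_sq_of_hasDerivAt (G' := fun φ => -tau φ (X φ - X θ)) ?_ ?_ ?_ ?_
  · filter_upwards [hh] with φ hφ
    refine (hφ.fun_sub (hasDerivAt_nu_const (X θ) φ)).congr_deriv ?_
    rw [map_sub]; ring
  · rw [supportAngle_eq h0, sub_self]
  · simp
  · simpa using (hasDerivAt_tau_moving (hX.sub_const (X θ))).fun_neg

/-! ### Curvature from the curve of support points -/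

/-- A support point whose normal makes an acute angle with `u_K(z)` lies on the graph. -/
lemma boundaryGraph_eq {x : ℂ} {φ : ℝ} (hu : gaussMap K z = dir θ)
    (hx : x ∈ exposedFace K (dir φ)) (hcos : 0 < Real.cos (φ - θ)) :
    boundaryGraph K z (tau θ (x - z)) = nu θ (x - z) := by
  rw [boundaryGraph, hu]
  refine IsLeast.csInf_eq ⟨?_, fun η hη => ?_⟩
  · change ofCoords θ z _ _ ∈ K
    rw [ofCoords_coords]; exact hx.1
  · change ofCoords θ z _ _ ∈ K at hη
    have h := hx.2 _ hη
    rw [inner_dir, inner_dir, ← sub_nonneg, ← map_sub,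
      ← sub_sub_sub_cancel_right _ _ z, nu_rotate θ, map_sub (nu θ) (_ - z),
      map_sub (tau θ) (_ - z), nu_ofCoords, tau_ofCoords,
      sub_self, zero_mul, sub_zero] at h
    exact sub_nonneg.1 (nonneg_of_mul_nonneg_left h hcos)

/-- The graph of `∂K` satisfies `2 f(ξ) / ξ² → 1 / r`, where `r` is the speed of the curve of
support points. -/
lemma tendsto_boundaryGraph {m : ℕ} (hm : m ≠ 0) (hu : gaussMap K z = dir θ) (hXz : X θ = z)
    (hX : ContDiffAt ℝ m X θ) (hface : ∀ᶠ t in 𝓝 θ, X t ∈ exposedFace K (dir t))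
    (hX' : deriv X θ ≠ 0) :
    ∃ r : ℝ, 0 < r ∧
      Tendsto (fun ξ => 2 * boundaryGraph K z ξ / ξ ^ 2) (𝓝[≠] 0) (𝓝 (1 / r)) := by
  have hm' : (m : WithTop ℕ∞) ≠ 0 := by exact_mod_cast hm
  have hd : HasDerivAt X (deriv X θ) θ := (hX.differentiableAt hm').hasDerivAt
  set r := tau θ (deriv X θ) with hr
  have hr0 : r ≠ 0 := by
    intro h0
    apply hX'
    refine eq_of_coords_eq (θ := θ) (z := 0) ?_ ?_
    · simpa using h0
    · simpa using nu_deriv_eq_zero hd hface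
  have hne : ∀ᶠ t in 𝓝[≠] θ, t ≠ θ := eventually_mem_nhdsWithin
  have hG := tendsto_supportAngle_div_sq
    (eventually_hasDerivAt_supportAngle hm hX hface) hd hface.self_of_nhds
  have hcos : Tendsto (fun φ => Real.cos (φ - θ)) (𝓝 θ) (𝓝 1) := by
    have : Continuous (fun φ => Real.cos (φ - θ)) := by fun_prop
    simpa using this.tendsto θ
  have hsin : Tendsto (fun φ => Real.sin (φ - θ) / (φ - θ)) (𝓝[≠] θ) (𝓝 1) := by
    have h := ((hasDerivAt_id θ).sub_const θ).sin
    rw [hasDerivAt_iff_tendsto_slope] at h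
    simpa [slope_fun_def_field] using h
  have hξ : Tendsto (fun φ => tau θ (X φ - z) / (φ - θ)) (𝓝[≠] θ) (𝓝 r) := by
    have h := (hd.sub_const z).tau_comp θ
    rw [hasDerivAt_iff_tendsto_slope] at h
    simpa [slope_fun_def_field, hXz] using h
  -- Solve `⟨X(φ) - z, e^{iφ}⟩ = η cos (φ - θ) - ξ sin (φ - θ)` for `η`.
  have hη : Tendsto (fun φ => nu θ (X φ - z) / (φ - θ) ^ 2) (𝓝[≠] θ) (𝓝 (r / 2)) := by
    have h := (hG.add (hξ.mul hsin)).div (hcos.mono_left nhdsWithin_le_nhds) one_ne_zero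
    rw [show (-r / 2 + r * 1) / 1 = r / 2 by ring] at h
    refine h.congr' ?_
    filter_upwards [hne, nhdsWithin_le_nhds hface,
      nhdsWithin_le_nhds (hcos.eventually_ne one_ne_zero)] with φ h1 h2 h3
    have h1' : φ - θ ≠ 0 := sub_ne_zero.2 h1
    have h4 := nu_rotate θ φ (X φ - z)
    rw [map_sub (nu φ)] at h4
    simp only [Pi.div_apply]
    rw [supportAngle_eq h2, hXz, h4]
    field_simp
    ring
  have hr_pos : 0 < r := by
    refine lt_of_le_of_ne ?_ hr0.symm
    have : 0 ≤ r / 2 := by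
      refine ge_of_tendsto hη ?_
      filter_upwards [nhdsWithin_le_nhds hface] with φ h
      have := hface.self_of_nhds.2 _ h.1
      rw [inner_dir, inner_dir, hXz] at this
      rw [map_sub]
      have : 0 ≤ nu θ (X φ) - nu θ z := sub_nonneg.2 this
      positivity
    linarith
  refine ⟨r, hr_pos, ?_⟩
  have hq : Tendsto (fun φ => 2 * nu θ (X φ - z) / (tau θ (X φ - z)) ^ 2) (𝓝[≠] θ)
      (𝓝 (1 / r)) := by
    have h := (hη.const_mul 2).div (hξ.pow 2) (pow_ne_zero 2 hr0)
    rw [show 2 * (r / 2) / r ^ 2 = 1 / r by field_simp] at h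
    refine h.congr' ?_
    filter_upwards [hne] with φ h1
    have h1' : φ - θ ≠ 0 := sub_ne_zero.2 h1
    simp only [Pi.div_apply]
    field_simp
  -- `φ ↦ ξ(X(φ))` carries the neighbourhoods of `θ` exactly to those of `0`.
  have hmap : map (fun φ => tau θ (X φ - z)) (𝓝 θ) = 𝓝 0 := by
    have hs := (tau θ).hasStrictFDerivAt.comp_hasStrictDerivAt θ
      ((hX.hasStrictDerivAt hm').sub_const z)
    have := hs.map_nhds_eq hr0
    simpa [Function.comp_def, hXz] using this
  intro V hV
  rw [mem_map, mem_nhdsWithin_iff_eventually, ← hmap, eventually_map]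
  filter_upwards [eventually_nhdsWithin_iff.1 (hq.eventually hV), hface,
    hcos.eventually_const_lt one_pos] with φ h1 h2 h3 h4
  have h5 : φ ≠ θ := by
    rintro rfl
    exact h4 (by simp [hXz])
  rw [Set.mem_preimage, boundaryGraph_eq hu h2 h3]
  exact h1 h5

lemma exists_hasRadiusOfCurvature {r : ℝ} (hr : 0 < r)
    (h : Tendsto (fun ξ => 2 * boundaryGraph K z ξ / ξ ^ 2) (𝓝[≠] 0) (𝓝 (1 / r))) :
    ∃ ρ : ℝ≥0∞, HasRadiusOfCurvature K z ρ ∧ 0 < ρ ∧ ρ < ∞ := by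
  have h' := (ENNReal.continuous_ofReal.tendsto _).comp h
  have hU : upperCurvature K z = ENNReal.ofReal (1 / r) := h'.limsup_eq
  have hL : lowerCurvature K z = ENNReal.ofReal (1 / r) := h'.liminf_eq
  refine ⟨_, ⟨hU.trans hL.symm, rfl⟩, ?_, ?_⟩
  · rw [hU, ENNReal.inv_pos]; exact ENNReal.ofReal_ne_top
  · rw [hU, ENNReal.inv_lt_top, ENNReal.ofReal_pos]; positivity

/-! ### From the Gauss map to the support function -/

/-- Composing the local inverse of the Gauss map with `φ ↦ e^{iφ}` gives a curve of support points;
its velocity does not vanish because the Gauss map is differentiable and takes the curve back to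
`φ ↦ e^{iφ}`. -/
lemma exists_supportCurve_of_isDiffeoAt {m : ℕ} (hm : m ≠ 0) (hz : z ∈ regExp K)
    (hu : gaussMap K z = dir θ)
    (hD : IsDiffeoAt m (gaussMap K) (regExp K) (Metric.sphere (0 : ℂ) 1) z) :
    ∃ X : ℝ → ℂ, X θ = z ∧ ContDiffAt ℝ m X θ ∧
      (∀ᶠ t in 𝓝 θ, X t ∈ exposedFace K (dir t)) ∧ deriv X θ ≠ 0 := by
  have hm' : (m : WithTop ℕ∞) ≠ 0 := by exact_mod_cast hm
  obtain ⟨U, W, hU, hW, hzU, hzW, -, hF, g, hgm, hinv, hg⟩ := hD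
  rw [hu] at hzW
  have hgz : g (dir θ) = z := by rw [← hu]; exact hinv.1 ⟨hz, hzU⟩
  have hmem : ∀ t, dir t ∈ Metric.sphere (0 : ℂ) 1 := fun t => by simp [norm_dir]
  have hdc : ContinuousAt dir θ := (hasDerivAt_dir θ).continuousAt
  have hW' : ∀ᶠ t in 𝓝 θ, dir t ∈ Metric.sphere (0 : ℂ) 1 ∩ W :=
    (hdc.eventually (hW.mem_nhds hzW)).mono fun t ht => ⟨hmem t, ht⟩
  obtain ⟨G, hG, hgG⟩ := hg (dir θ) ⟨hmem θ, hzW⟩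
  obtain ⟨F, hF, huF⟩ := hF z ⟨hz, hzU⟩
  have hX : ContDiffAt ℝ m (fun t => g (dir t)) θ := by
    refine (hG.comp θ contDiff_dir.contDiffAt).congr_of_eventuallyEq ?_
    exact (tendsto_nhdsWithin_iff.2 ⟨hdc, hW'⟩).eventually hgG
  refine ⟨fun t => g (dir t), hgz, hX, ?_, ?_⟩
  · filter_upwards [hW'] with t ht
    have h1 := exposedFace_gaussMap (hgm ht).1
    rw [hinv.2 ht] at h1
    rw [h1]; rfl
  · intro h0
    have hd : HasDerivAt (fun t => g (dir t)) 0 θ := by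
      rw [← h0]; exact (hX.differentiableAt hm').hasDerivAt
    have hlim : Tendsto (fun t => g (dir t)) (𝓝 θ) (𝓝[regExp K ∩ U] z) := by
      refine tendsto_nhdsWithin_iff.2 ⟨?_, hW'.mono fun t ht => hgm ht⟩
      simpa [ContinuousAt, hgz] using hd.continuousAt
    have hFd : HasFDerivAt F (fderiv ℝ F z) (g (dir θ)) := by
      rw [hgz]; exact (hF.differentiableAt hm').hasFDerivAt
    have hcomp := hFd.comp_hasDerivAt θ hd
    -- `F ∘ X` is `φ ↦ e^{iφ}`, whose derivative is not zero.
    have hdir : HasDerivAt dir (fderiv ℝ F z 0) θ := by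
      refine hcomp.congr_of_eventuallyEq ?_
      filter_upwards [hW', hlim.eventually huF] with t ht h2
      simpa [hinv.2 ht] using h2
    have := hdir.unique (hasDerivAt_dir θ)
    simp [dir_ne_zero] at this

/-! ### From the support function to the curve of support points -/

/-- Where the support function is differentiable, the exposed face is the single point determined by
the value and the derivative. -/
lemma exposedFace_eq_singleton (hK : IsCompact K) (hne : K.Nonempty) {φ : ℝ}
    (hh : DifferentiableAt ℝ (supportAngle K) φ) :
    exposedFace K (dir φ) = {ofCoords φ 0 (-deriv (supportAngle K) φ) (supportAngle K φ)} := by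
  refine Set.Nonempty.subset_singleton_iff (exists_mem_exposedFace hK hne _) |>.1 fun x hx => ?_
  have hmax : IsLocalMax (fun t => supportAngle K t - nu t x) φ := by
    refine Eventually.of_forall fun t => ?_
    simp only [supportAngle_eq hx, sub_self, sub_nonpos]
    exact supportAngle_le hK hx.1 t
  have h0 := hmax.hasDerivAt_eq_zero (hh.hasDerivAt.fun_sub (hasDerivAt_nu_const x φ))
  rw [Set.mem_singleton_iff]
  refine eq_of_coords_eq (θ := φ) (z := 0) ?_ ?_
  · rw [tau_ofCoords, sub_zero]; linarith
  · rw [nu_ofCoords, sub_zero, supportAngle_eq hx]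

lemma exists_supportCurve_of_contDiffAt (hK : IsCompact K) (hne : K.Nonempty) {m : ℕ}
    (hh : ContDiffAt ℝ (m + 1 : ℕ) (supportAngle K) θ) :
    ∃ X : ℝ → ℂ, ContDiffAt ℝ m X θ ∧ ∀ᶠ t in 𝓝 θ, exposedFace K (dir t) = {X t} := by
  refine ⟨fun t => ofCoords t 0 (-deriv (supportAngle K) t) (supportAngle K t), ?_, ?_⟩
  · have h1 : ContDiffAt ℝ m (deriv (supportAngle K)) θ := hh.derivWithin (by push_cast; rfl)
    have h2 : ContDiffAt ℝ m (supportAngle K) θ := hh.of_le (by exact_mod_cast m.le_succ)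
    have h3 : ContDiffAt ℝ m dir θ := contDiff_dir.contDiffAt
    exact (contDiffAt_const.add (h1.neg.smul (contDiffAt_const.mul h3))).add (h2.smul h3)
  · filter_upwards [hh.eventually (by simp)] with t ht
    exact exposedFace_eq_singleton hK hne (ht.differentiableAt (by norm_cast))

/-- If the graph of `∂K` lies below the parabola `η = C ξ²` on one side, then the curve of support
points has positive speed: testing the support function at the points over `ξ = t / (2 C)` bounds
its second-order term away from zero. -/
lemma tau_deriv_pos {X' : ℂ} {f : ℝ → ℝ} {C : ℝ} (hK : IsCompact K)
    (hh : ∀ᶠ φ in 𝓝 θ, HasDerivAt (supportAngle K) (-tau φ (X φ)) φ)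
    (hX : HasDerivAt X X' θ) (h0 : X θ ∈ exposedFace K (dir θ)) (hC : 0 < C)
    (hf : ∀ᶠ ξ in 𝓝[>] 0, ofCoords θ (X θ) ξ (f ξ) ∈ K ∧ f ξ ≤ C * ξ ^ 2) :
    0 < tau θ X' := by
  have hshift : Tendsto (fun t : ℝ => θ + t) (𝓝[>] 0) (𝓝[≠] θ) := by
    refine tendsto_nhdsWithin_iff.2 ⟨?_, ?_⟩
    · have : Continuous (fun t : ℝ => θ + t) := by fun_prop
      simpa using (this.tendsto 0).mono_left nhdsWithin_le_nhds
    · filter_upwards [self_mem_nhdsWithin] with t ht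
      simpa using (ne_of_gt ht)
  have hG := (tendsto_supportAngle_div_sq hh hX h0).comp hshift
  have hsin : Tendsto (fun t : ℝ => Real.sin t / t) (𝓝[>] 0) (𝓝 1) := by
    have h := hasDerivAt_iff_tendsto_slope.1 (Real.hasDerivAt_sin 0)
    have h' := h.mono_left (nhdsWithin_mono (0 : ℝ) (s := Set.Ioi 0) (fun t ht => ne_of_gt ht))
    simpa [slope_fun_def_field] using h'
  have hbound : Tendsto (fun t : ℝ => 1 / (4 * C) - 1 / (2 * C) * (Real.sin t / t)) (𝓝[>] 0)
      (𝓝 (1 / (4 * C) - 1 / (2 * C) * 1)) := (hsin.const_mul _).const_sub _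
  have hscale : Tendsto (fun t : ℝ => t / (2 * C)) (𝓝[>] 0) (𝓝[>] 0) := by
    refine tendsto_nhdsWithin_iff.2 ⟨?_, ?_⟩
    · have : Continuous (fun t : ℝ => t / (2 * C)) := by fun_prop
      simpa using (this.tendsto 0).mono_left nhdsWithin_le_nhds
    · filter_upwards [self_mem_nhdsWithin] with t ht
      have ht : 0 < t := ht
      exact (by positivity : 0 < t / (2 * C))
  have hle : -tau θ X' / 2 ≤ 1 / (4 * C) - 1 / (2 * C) * 1 := by
    refine le_of_tendsto_of_tendsto hG hbound ?_
    filter_upwards [self_mem_nhdsWithin, hscale.eventually hf] with t ht hft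
    have ht : 0 < t := ht
    have h1 := supportAngle_le hK hft.1 (θ + t)
    have h2 := h0.2 _ hft.1
    have hpos : 0 ≤ f (t / (2 * C)) := by
      rw [inner_dir, inner_dir, ← sub_nonneg, ← map_sub, nu_ofCoords] at h2
      exact h2
    rw [← sub_le_sub_iff_right (nu (θ + t) (X θ)), ← map_sub (nu (θ + t)), nu_rotate θ _ (_ - _),
      nu_ofCoords, tau_ofCoords, add_sub_cancel_left] at h1
    have h3 : f (t / (2 * C)) * Real.cos t ≤ C * (t / (2 * C)) ^ 2 :=
      (mul_le_of_le_one_right hpos (Real.cos_le_one t)).trans hft.2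
    simp only [Function.comp_apply, add_sub_cancel_left]
    rw [div_le_iff₀ (by positivity)]
    calc _ ≤ _ := h1
      _ ≤ C * (t / (2 * C)) ^ 2 - t / (2 * C) * Real.sin t := by linarith
      _ = _ := by field_simp; ring
  have : 1 / (4 * C) - 1 / (2 * C) * 1 = -(1 / (4 * C)) := by field_simp; ring
  have h4 : 0 < 1 / (4 * C) := by positivity
  linarith

/-- Over every small `ξ > 0` the graph point belongs to `K`: otherwise `K` would lie on one side of
the normal line at `z` and `z` would have a second normal. -/
lemma eventually_ofCoords_boundaryGraph_mem (hK : IsCompact K) (hc : Convex ℝ K)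
    (hz : z ∈ reg K) (hu : gaussMap K z = dir θ) :
    ∀ᶠ ξ in 𝓝[>] 0, ofCoords θ z ξ (boundaryGraph K z ξ) ∈ K := by
  obtain ⟨hzK, -, huniq⟩ := hz
  have hn := gaussMap_spec huniq
  obtain ⟨p, hp, hpos⟩ : ∃ p ∈ K, 0 < tau θ (p - z) := by
    by_contra! hcon
    have h2 : IsInnerUnitNormal K z (Complex.I * dir θ) := by
      refine ⟨by simp [norm_dir], fun y hy => ?_⟩
      have := hcon y hy
      rw [← inner_neg_I_mul_dir, neg_mul, inner_neg_right] at this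
      linarith
    have h3 := gaussMap_eq huniq h2
    rw [hu] at h3
    have h4 : (1 : ℂ) = Complex.I := mul_right_cancel₀ (dir_ne_zero θ) (by simpa using h3)
    simpa using congrArg Complex.re h4
  filter_upwards [Ioo_mem_nhdsGT hpos] with ξ hξ
  have hcont : Continuous (fun η : ℝ => ofCoords θ z ξ η) := by unfold ofCoords; fun_prop
  have hmem := IsClosed.csInf_mem (s := {η : ℝ | ofCoords θ z ξ η ∈ K})
    (hK.isClosed.preimage hcont) ?_ ?_
  · rw [boundaryGraph, hu]; exact hmem
  · set s := ξ / tau θ (p - z) with hs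
    have hs0 : 0 ≤ s := (div_pos hξ.1 hpos).le
    have hs1 : s ≤ 1 := (div_le_one hpos).2 hξ.2.le
    have hq : z + s • (p - z) ∈ K := hc.add_smul_sub_mem hzK hp ⟨hs0, hs1⟩
    refine ⟨nu θ (z + s • (p - z) - z), ?_⟩
    have hξs : ξ = tau θ (z + s • (p - z) - z) := by
      rw [add_sub_cancel_left, map_smul, smul_eq_mul, hs, div_mul_cancel₀ _ hpos.ne']
    change ofCoords θ z ξ _ ∈ K
    nth_rewrite 1 [hξs]
    rwa [ofCoords_coords]
  · refine ⟨0, fun η hη => ?_⟩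
    have := hn.2 _ hη
    rwa [hu, inner_dir, nu_ofCoords] at this

lemma exists_boundaryGraph_le (hU : upperCurvature K z < ∞) :
    ∃ C : ℝ, 0 < C ∧ ∀ᶠ ξ in 𝓝[>] 0, boundaryGraph K z ξ ≤ C * ξ ^ 2 := by
  obtain ⟨c, hc, -⟩ := ENNReal.lt_iff_exists_nnreal_btwn.1 hU
  refine ⟨c + 1, by positivity, ?_⟩
  have h1 := Filter.eventually_lt_of_limsup_lt hc
  have h2 : 𝓝[>] (0 : ℝ) ≤ 𝓝[≠] 0 := nhdsWithin_mono _ (fun t ht => ne_of_gt ht)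
  filter_upwards [h2 h1, self_mem_nhdsWithin] with ξ hξ hpos
  have hpos : 0 < ξ := hpos
  have h3 : 2 * boundaryGraph K z ξ / ξ ^ 2 ≤ c := by
    exact ENNReal.ofReal_le_coe.1 hξ.le
  rw [div_le_iff₀ (by positivity)] at h3
  have : 0 ≤ (c : ℝ) * ξ ^ 2 := by positivity
  nlinarith [sq_nonneg ξ]

end SupportCurve

/-! ### Regularity of the support points -/

lemma inner_eq_coords (φ : ℝ) (p q : ℂ) :
    inner ℝ p q = tau φ p * tau φ q + nu φ p * nu φ q := by
  simp only [inner_eq, tau_apply, nu_apply]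
  linear_combination (-(p.re * q.re + p.im * q.im)) * Real.sin_sq_add_cos_sq φ

section LocalChart

variable {K : Set ℂ} {X : ℝ → ℂ} {z : ℂ} {θ : ℝ} {m : ℕ}

/-- Where the curve of support points has nonzero velocity, every normal is orthogonal to the
velocity, hence is `e^{iφ}` or `-e^{iφ}`; the latter would make `K` a point. -/
lemma normal_eq_dir (hz : z ∈ reg K) {φ : ℝ} (hX : DifferentiableAt ℝ X φ)
    (hX' : deriv X φ ≠ 0) (hface : ∀ᶠ t in 𝓝 φ, exposedFace K (dir t) = {X t}) {v : ℂ}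
    (hv : IsInnerUnitNormal K (X φ) v) : v = dir φ := by
  have hmem : ∀ᶠ t in 𝓝 φ, X t ∈ exposedFace K (dir t) := hface.mono fun t ht => ht ▸ rfl
  have hXK : X φ ∈ K := hmem.self_of_nhds.1
  have h1 : nu φ (deriv X φ) = 0 := nu_deriv_eq_zero hX.hasDerivAt hmem
  have h2 := inner_deriv_eq_zero hX.hasDerivAt (hmem.mono fun t ht => ht.1)
    ((isInnerUnitNormal_iff hXK).1 hv).2
  rw [inner_eq_coords φ, h1, zero_mul, add_zero] at h2
  have h3 : tau φ v = 0 := by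
    refine (mul_eq_zero.1 h2).resolve_left fun h => hX' ?_
    exact eq_of_coords_eq (θ := φ) (z := 0) (by simpa using h) (by simpa using h1)
  have h4 : nu φ v ^ 2 = 1 := by
    have h5 := real_inner_self_eq_norm_sq v
    rw [inner_eq_coords φ, hv.1, h3] at h5
    linarith
  have hcoord : v = ofCoords φ 0 0 (nu φ v) := by
    conv_lhs => rw [← ofCoords_coords φ 0 v]
    rw [sub_zero, h3]
  rcases eq_or_eq_neg_of_sq_eq_sq (nu φ v) 1 (by rw [h4, one_pow]) with h | h
  · rw [hcoord, h]; simp [ofCoords]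
  · rw [h] at hcoord
    have hv' : v = -dir φ := by rw [hcoord]; simp [ofCoords]
    have hsingle : ∀ y ∈ K, y = X φ := fun y hy => by
      have h6 := ((isInnerUnitNormal_iff hXK).1 hv).2.2 y hy
      rw [hv', inner_neg_right, inner_neg_right, neg_le_neg_iff] at h6
      have : y ∈ exposedFace K (dir φ) :=
        ⟨hy, fun w hw => h6.trans (hmem.self_of_nhds.2 w hw)⟩
      rwa [hface.self_of_nhds] at this
    have hK : K = {z} := Set.eq_singleton_iff_unique_mem.2
      ⟨hz.1, fun y hy => (hsingle y hy).trans (hsingle z hz.1).symm⟩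
    have := hz.2.2
    rw [hK] at this
    exact absurd this not_existsUnique_normal_singleton

lemma notMem_interior_of_mem_exposedFace {x : ℂ} {φ : ℝ} (hx : x ∈ exposedFace K (dir φ)) :
    x ∉ interior K := by
  intro hint
  -- The line through an interior point `x` along `e^{iφ}` stays in `K` near `x`, but
  -- `⟨·, e^{iφ}⟩` is not stationary along it.
  have hd : HasDerivAt (fun t : ℝ => x + t • dir φ) (dir φ) 0 := by
    simpa using ((hasDerivAt_id (0 : ℝ)).smul_const (dir φ)).const_add x
  have h := inner_deriv_eq_zero (K := K) hd ?_ (u := dir φ) (by simpa using hx)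
  · rw [real_inner_self_eq_norm_sq, norm_dir] at h
    norm_num at h
  · refine hd.continuousAt.eventually ?_
    simpa using mem_interior_iff_mem_nhds.1 hint

lemma supportPoint_mem_regExp (hz : z ∈ reg K) {φ : ℝ} (hX : DifferentiableAt ℝ X φ)
    (hX' : deriv X φ ≠ 0) (hface : ∀ᶠ t in 𝓝 φ, exposedFace K (dir t) = {X t}) :
    X φ ∈ regExp K ∧ gaussMap K (X φ) = dir φ := by
  have hf := hface.self_of_nhds
  have hmem : X φ ∈ exposedFace K (dir φ) := hf ▸ rfl
  have hn : IsInnerUnitNormal K (X φ) (dir φ) :=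
    (isInnerUnitNormal_iff hmem.1).2 ⟨norm_dir φ, hmem⟩
  have huniq : ∃! u : ℂ, IsInnerUnitNormal K (X φ) u :=
    ⟨_, hn, fun v hv => normal_eq_dir hz hX hX' hface hv⟩
  refine ⟨⟨⟨hmem.1, ⟨subset_closure hmem.1, notMem_interior_of_mem_exposedFace hmem⟩, huniq⟩,
    hmem.1, -nu φ, fun y hy => ?_⟩, gaussMap_eq huniq hn⟩
  have hle := hmem.2 y hy
  rw [inner_dir, inner_dir] at hle
  refine ⟨by simpa using hle, fun h => ?_⟩
  have h' : nu φ y ≤ nu φ (X φ) := by simpa using h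
  have : y ∈ exposedFace K (dir φ) := by
    refine ⟨hy, fun w hw => ?_⟩
    have := hmem.2 w hw
    rw [inner_dir, inner_dir] at this ⊢
    exact h'.trans this
  rwa [hf] at this

/-! ### The boundary as a graph over the tangent -/

/-- In the neighbourhood `U` of `z` the regular exposed points are points `X(φ)` of the curve of
support points, and the tangential coordinate `φ ↦ ⟨X(φ) - z, -i e^{iθ}⟩` restricts to the local
homeomorphism `e` with nonzero derivative. The source of `e` is a neighbourhood of `θ` on which `X`
is of class `C^m` and consists of regular exposed points, with normal `e^{iφ}` at `X(φ)`. -/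
structure IsGraphChart (K : Set ℂ) (X : ℝ → ℂ) (z : ℂ) (θ : ℝ) (m : ℕ)
    (e : OpenPartialHomeomorph ℝ ℝ) (U : Set ℂ) : Prop where
  isOpen : IsOpen U
  mem : z ∈ U
  mem_source : θ ∈ e.source
  apply_eq : X θ = z
  coe_eq : ⇑e = fun φ => tau θ (X φ - z)
  abs_lt : ∀ φ ∈ e.source, |φ - θ| < Real.pi / 2
  contDiffAt : ∀ φ ∈ e.source, ContDiffAt ℝ m X φ
  tau_deriv_ne : ∀ φ ∈ e.source, tau θ (deriv X φ) ≠ 0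
  nu_deriv : ∀ φ ∈ e.source, nu φ (deriv X φ) = 0
  mem_regExp : ∀ φ ∈ e.source, X φ ∈ regExp K
  gaussMap_eq : ∀ φ ∈ e.source, gaussMap K (X φ) = dir φ
  mem_target : ∀ y ∈ U, tau θ (y - z) ∈ e.target
  exists_eq : ∀ y ∈ regExp K ∩ U, ∃ φ ∈ e.source, y = X φ

lemma exists_isGraphChart (hm : m ≠ 0) (hz : z ∈ reg K) (hu : gaussMap K z = dir θ)
    (hXz : X θ = z) (hX : ContDiffAt ℝ m X θ)
    (hface : ∀ᶠ t in 𝓝 θ, exposedFace K (dir t) = {X t}) (hr : tau θ (deriv X θ) ≠ 0) :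
    ∃ e U, IsGraphChart K X z θ m e U := by
  have hm' : (m : WithTop ℕ∞) ≠ 0 := by exact_mod_cast hm
  have hmem : ∀ᶠ t in 𝓝 θ, X t ∈ exposedFace K (dir t) := hface.mono fun t ht => ht ▸ rfl
  have hξ : ContDiffAt ℝ m (fun φ => tau θ (X φ - z)) θ :=
    (tau θ).contDiff.contDiffAt.comp θ (hX.sub contDiffAt_const)
  have hξd : HasDerivAt (fun φ => tau θ (X φ - z)) (tau θ (deriv X θ)) θ :=
    ((hX.differentiableAt hm').hasDerivAt.sub_const z).tau_comp θ
  let e₀ := hξ.toOpenPartialHomeomorph _ (hξd.hasFDerivAt_equiv hr) hm'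
  have hderiv : ContinuousAt (deriv X) θ := by
    have : ContDiffAt ℝ 0 (deriv X) θ :=
      hX.derivWithin (by rw [zero_add]; exact_mod_cast Nat.one_le_iff_ne_zero.2 hm)
    exact this.continuousAt
  have hr' : ∀ᶠ φ in 𝓝 θ, tau θ (deriv X φ) ≠ 0 :=
    ((tau θ).continuous.continuousAt.comp hderiv).eventually_ne hr
  have habs : ∀ᶠ φ in 𝓝 θ, |φ - θ| < Real.pi / 2 := by
    have : Continuous (fun φ => |φ - θ|) := by fun_prop
    exact (this.tendsto θ).eventually_lt_const (by simpa using Real.pi_div_two_pos)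
  obtain ⟨I, hI, hIo, hθI⟩ := eventually_nhds_iff.1
    (habs.and ((hX.eventually (by simp)).and (hr'.and hface.eventually_nhds)))
  let e := e₀.restrOpen I hIo
  have hsrc : ∀ φ ∈ e.source, φ ∈ I := fun φ hφ => hφ.2
  have hθe : θ ∈ e.source := ⟨hξ.mem_toOpenPartialHomeomorph_source _ hm', hθI⟩
  have hcoe : ⇑e = fun φ => tau θ (X φ - z) := rfl
  have hV : {v | angle θ v ∈ e.source} ∈ 𝓝 (dir θ) := by
    have h1 : dir θ / dir θ ∈ Complex.slitPlane := by simp [div_self (dir_ne_zero θ)]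
    have h2 := (contDiffAt_angle (n := 0) h1).continuousAt
    refine h2.preimage_mem_nhds ?_
    rw [angle_dir (by simpa using Real.pi_pos)]
    exact e.open_source.mem_nhds hθe
  have hnormal := eventually_normal_mem (K := K) (z := z) (u := dir θ)
    (fun v hv => (gaussMap_eq hz.2.2 hv).symm.trans hu) hV
  have hcont : Continuous (fun y => tau θ (y - z)) := by fun_prop
  have htz : tau θ (z - z) ∈ e.target := by
    have := e.map_source hθe
    simpa only [hcoe, hXz] using this
  refine ⟨e, interior {y | ∀ v, IsInnerUnitNormal K y v → v ∈ {v | angle θ v ∈ e.source}} ∩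
    (fun y => tau θ (y - z)) ⁻¹' e.target, ?_⟩
  have hreg : ∀ φ ∈ e.source, X φ ∈ regExp K ∧ gaussMap K (X φ) = dir φ := fun φ hφ => by
    obtain ⟨-, h2, h3, h4⟩ := hI φ (hsrc φ hφ)
    exact supportPoint_mem_regExp hz (h2.differentiableAt hm') (fun h => h3 (by simp [h])) h4
  exact
    { isOpen := isOpen_interior.inter (e.open_target.preimage hcont)
      mem := ⟨mem_interior_iff_mem_nhds.2 hnormal, htz⟩
      mem_source := hθe
      apply_eq := hXz
      coe_eq := hcoe
      abs_lt := fun φ hφ => (hI φ (hsrc φ hφ)).1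
      contDiffAt := fun φ hφ => (hI φ (hsrc φ hφ)).2.1
      tau_deriv_ne := fun φ hφ => (hI φ (hsrc φ hφ)).2.2.1
      nu_deriv := fun φ hφ => by
        obtain ⟨-, h2, -, h4⟩ := hI φ (hsrc φ hφ)
        exact nu_deriv_eq_zero (K := K) (h2.differentiableAt hm').hasDerivAt
          (h4.mono fun t ht => ht ▸ rfl)
      mem_regExp := fun φ hφ => (hreg φ hφ).1
      gaussMap_eq := fun φ hφ => (hreg φ hφ).2
      mem_target := fun y hy => hy.2
      exists_eq := fun y hy => by
        have hn := gaussMap_spec hy.1.1.2.2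
        have hφ : angle θ (gaussMap K y) ∈ e.source := interior_subset hy.2.1 _ hn
        refine ⟨_, hφ, ?_⟩
        have h5 := ((isInnerUnitNormal_iff hy.1.1.1).1 hn).2
        rw [← dir_angle θ hn.1, (hI _ (hsrc _ hφ)).2.2.2.self_of_nhds] at h5
        exact h5 }

namespace IsGraphChart

variable {e : OpenPartialHomeomorph ℝ ℝ} {U : Set ℂ} (hc : IsGraphChart K X z θ m e U)
include hc

lemma hasDerivAt (hm : m ≠ 0) {φ : ℝ} (hφ : φ ∈ e.source) :
    HasDerivAt X (deriv X φ) φ :=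
  ((hc.contDiffAt φ hφ).differentiableAt (by exact_mod_cast hm)).hasDerivAt

lemma hasDerivAt_coe (hm : m ≠ 0) {φ : ℝ} (hφ : φ ∈ e.source) :
    HasDerivAt e (tau θ (deriv X φ)) φ := by
  rw [hc.coe_eq]
  exact ((hc.hasDerivAt hm hφ).sub_const z).tau_comp θ

lemma contDiffAt_symm (hm : m ≠ 0) {s : ℝ} (hs : s ∈ e.target) : ContDiffAt ℝ m e.symm s := by
  have hφ := e.map_target hs
  refine e.contDiffAt_symm_deriv (hc.tau_deriv_ne _ hφ) hs (hc.hasDerivAt_coe hm hφ) ?_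
  rw [hc.coe_eq]
  exact (tau θ).contDiff.contDiffAt.comp _ ((hc.contDiffAt _ hφ).sub contDiffAt_const)

/-- The function of which `∂K` is the graph is smoother by one order than the curve of support
points, because its slope is the tangent of the angle between the normals. -/
lemma contDiffAt_graph (hm : m ≠ 0) {s : ℝ} (hs : s ∈ e.target) :
    ContDiffAt ℝ (m + 1 : ℕ) (fun s => nu θ (X (e.symm s) - z)) s := by
  have hcos : ∀ s ∈ e.target, Real.cos (e.symm s - θ) ≠ 0 := fun s hs =>
    (Real.cos_pos_of_mem_Ioo (_root_.abs_lt.1 (hc.abs_lt _ (e.map_target hs)) |> fun h =>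
      ⟨by linarith [h.1], h.2⟩)).ne'
  refine contDiffAt_succ_of_hasDerivAt
    (g := fun s => Real.sin (e.symm s - θ) / Real.cos (e.symm s - θ)) ?_ ?_
  · filter_upwards [e.open_target.mem_nhds hs] with s hs
    have hφ := e.map_target hs
    have h1 := e.hasDerivAt_symm hs (hc.tau_deriv_ne _ hφ) (hc.hasDerivAt_coe hm hφ)
    have h2 := (((hc.hasDerivAt hm hφ).sub_const z).nu_comp θ).comp s h1
    refine h2.congr_deriv ?_
    have h3 := hc.nu_deriv _ hφ
    rw [nu_rotate θ] at h3
    have h4 := hc.tau_deriv_ne _ hφ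
    have h5 := hcos s hs
    field_simp
    linarith
  · have h := (hc.contDiffAt_symm hm hs).sub (contDiffAt_const (c := θ))
    exact h.sin.div h.cos (hcos s hs)

lemma mem_regExp_iff {y : ℂ} (hy : y ∈ U) :
    y ∈ regExp K ↔ nu θ (y - z) = nu θ (X (e.symm (tau θ (y - z))) - z) := by
  constructor
  · intro h
    obtain ⟨φ, hφ, rfl⟩ := hc.exists_eq y ⟨h, hy⟩
    rw [show tau θ (X φ - z) = e φ by rw [hc.coe_eq], e.left_inv hφ]
  · intro h
    have hφ := e.map_target (hc.mem_target y hy)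
    have h1 := e.right_inv (hc.mem_target y hy)
    rw [hc.coe_eq] at h1
    rw [eq_of_coords_eq h1.symm h]
    exact hc.mem_regExp _ hφ

/-- The graph is straightened by the shear `(ξ, η) ↦ (ξ, η - f(ξ))`. -/
lemma isSubmanifoldAt (hm : m ≠ 0) : IsSubmanifoldAt (m + 1) (regExp K) z := by
  refine ⟨U, hc.isOpen, hc.mem, fun p hp => ?_⟩
  obtain ⟨f, hfc, hreg⟩ : ∃ f : ℝ → ℝ, (∀ s ∈ e.target, ContDiffAt ℝ (m + 1 : ℕ) f s) ∧
      ∀ y ∈ U, y ∈ regExp K ↔ nu θ (y - z) = f (tau θ (y - z)) :=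
    ⟨_, fun s hs => hc.contDiffAt_graph hm hs, fun y hy => hc.mem_regExp_iff hy⟩
  set a := tau θ (p - z)
  let F : ℂ → ℝ × ℝ := fun y => (tau θ (y - z) - a, nu θ (y - z) - f (tau θ (y - z)))
  let G : ℝ × ℝ → ℂ := fun q => ofCoords θ z (q.1 + a) (q.2 + f (q.1 + a))
  have hGF : ∀ y, G (F y) = y := fun y => by
    simp only [F, G, sub_add_cancel, ofCoords_coords]
  have hFG : ∀ q, F (G q) = q := fun q => by
    simp only [F, G, tau_ofCoords, nu_ofCoords, add_sub_cancel_right]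
  have hF : ∀ y ∈ U, ContDiffAt ℝ (m + 1 : ℕ) F y := fun y hy => by
    have h1 : ContDiffAt ℝ (m + 1 : ℕ) (fun y => tau θ (y - z)) y := by fun_prop
    have h2 : ContDiffAt ℝ (m + 1 : ℕ) (fun y => nu θ (y - z)) y := by fun_prop
    exact (h1.sub contDiffAt_const).prodMk
      (h2.sub ((hfc _ (hc.mem_target y hy)).comp y h1))
  have hG : ∀ q : ℝ × ℝ, q.1 + a ∈ e.target → ContDiffAt ℝ (m + 1 : ℕ) G q := fun q hq => by
    have h1 : ContDiffAt ℝ (m + 1 : ℕ) (fun q : ℝ × ℝ => q.1 + a) q := by fun_prop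
    have h2 : ContDiffAt ℝ (m + 1 : ℕ) (fun q : ℝ × ℝ => q.2) q := by fun_prop
    exact (contDiffAt_const.add (h1.smul contDiffAt_const)).add
      ((h2.add ((hfc _ hq).comp q h1)).smul contDiffAt_const)
  have htar : ∀ q, G q ∈ U → q.1 + a ∈ e.target := fun q hq => by
    have := hc.mem_target _ hq
    rwa [tau_ofCoords] at this
  have hopen : IsOpen (G ⁻¹' U) := by
    rw [isOpen_iff_mem_nhds]
    exact fun q hq => (hG q (htar q hq)).continuousAt.preimage_mem_nhds (hc.isOpen.mem_nhds hq)
  let g : OpenPartialHomeomorph ℂ (ℝ × ℝ) :=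
    { toFun := F
      invFun := G
      source := U
      target := G ⁻¹' U
      map_source' := fun y hy => by rwa [Set.mem_preimage, hGF]
      map_target' := fun q hq => hq
      left_inv' := fun y _ => hGF y
      right_inv' := fun q _ => hFG q
      open_source := hc.isOpen
      open_target := hopen
      continuousOn_toFun := fun y hy => (hF y hy).continuousAt.continuousWithinAt
      continuousOn_invFun := fun q hq => (hG q (htar q hq)).continuousAt.continuousWithinAt }
  refine ⟨g, hp.2, ?_, fun y hy => (hF y hy).contDiffWithinAt,
    fun q hq => (hG q (htar q hq)).contDiffWithinAt, ?_⟩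
  · have := (hreg p hp.2).1 hp.1
    exact Prod.ext (sub_self _) (sub_eq_zero.2 this)
  · ext q
    constructor
    · rintro ⟨y, ⟨⟨hy, hyU⟩, -⟩, rfl⟩
      exact ⟨sub_eq_zero.2 ((hreg y hyU).1 hy), g.map_source hyU⟩
    · rintro ⟨hq, hqU : G q ∈ U⟩
      refine ⟨G q, ⟨⟨(hreg _ hqU).2 ?_, hqU⟩, hqU⟩, hFG q⟩
      have hq' : q.2 = 0 := hq
      have : (F (G q)).2 = 0 := by rw [hFG, hq']
      exact sub_eq_zero.1 this

lemma isDiffeoAt (hm : m ≠ 0) :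
    IsDiffeoAt m (gaussMap K) (regExp K) (Metric.sphere (0 : ℂ) 1) z := by
  -- On `S` the map `w ↦ X(angle w)` inverts the Gauss map and has values in `U`.
  let S : Set ℂ := {w | w / dir θ ∈ Complex.slitPlane ∧ angle θ w ∈ e.source ∧
    X (angle θ w) ∈ U}
  have hangle : ∀ φ ∈ e.source, angle θ (dir φ) = φ := fun φ hφ =>
    angle_dir ((hc.abs_lt φ hφ).trans (by linarith [Real.pi_pos]))
  have hslit : ∀ φ ∈ e.source, dir φ / dir θ ∈ Complex.slitPlane := fun φ hφ => by
    have h := _root_.abs_lt.1 (hc.abs_lt φ hφ)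
    rw [dir_div_dir]
    left
    rw [dir_re]
    exact Real.cos_pos_of_mem_Ioo ⟨by linarith [h.1], h.2⟩
  have hX : ∀ w ∈ S, ContDiffAt ℝ m (fun w => X (angle θ w)) w := fun w hw =>
    (hc.contDiffAt _ hw.2.1).comp w (contDiffAt_angle hw.1)
  have hS : IsOpen S := by
    rw [isOpen_iff_mem_nhds]
    intro w hw
    have h1 : ContinuousAt (fun w => w / dir θ) w := by fun_prop
    filter_upwards [h1.preimage_mem_nhds (Complex.isOpen_slitPlane.mem_nhds hw.1),
      (contDiffAt_angle (n := 0) hw.1).continuousAt.preimage_mem_nhds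
        (e.open_source.mem_nhds hw.2.1),
      (hX w hw).continuousAt.preimage_mem_nhds (hc.isOpen.mem_nhds hw.2.2)] with w' a b c
    exact ⟨a, b, c⟩
  have hmaps : ∀ y ∈ regExp K ∩ U, ∃ φ ∈ e.source, y = X φ ∧ gaussMap K y = dir φ ∧
      dir φ ∈ S := fun y hy => by
    obtain ⟨φ, hφ, rfl⟩ := hc.exists_eq y hy
    exact ⟨φ, hφ, rfl, hc.gaussMap_eq φ hφ, hslit φ hφ, by rwa [hangle φ hφ],
      by rw [hangle φ hφ]; exact hy.2⟩
  have hz : z ∈ regExp K ∩ U := ⟨hc.apply_eq ▸ hc.mem_regExp θ hc.mem_source, hc.mem⟩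
  refine ⟨U, S, hc.isOpen, hS, hc.mem, ?_, ?_, ?_, fun w => X (angle θ w), ?_, ⟨?_, ?_⟩, ?_⟩
  · obtain ⟨φ, hφ, -, h, hmem⟩ := hmaps z hz
    rwa [h]
  · intro y hy
    obtain ⟨φ, hφ, -, h, hmem⟩ := hmaps y hy
    rw [h]
    exact ⟨by simp [norm_dir], hmem⟩
  · intro x hx
    refine ⟨fun y => dir (e.symm (tau θ (y - z))), ?_, ?_⟩
    · have h1 : ContDiffAt ℝ m (fun y => tau θ (y - z)) x := by fun_prop
      exact contDiff_dir.contDiffAt.comp x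
        ((hc.contDiffAt_symm hm (hc.mem_target x hx.2)).comp x h1)
    · filter_upwards [self_mem_nhdsWithin] with y hy
      obtain ⟨φ, hφ, rfl, h, -⟩ := hmaps y hy
      rw [h, show tau θ (X φ - z) = e φ by rw [hc.coe_eq], e.left_inv hφ]
  · exact fun w hw => ⟨hc.mem_regExp _ hw.2.2.1, hw.2.2.2⟩
  · intro y hy
    obtain ⟨φ, hφ, rfl, h, -⟩ := hmaps y hy
    simp only [h, hangle φ hφ]
  · intro w hw
    simp only [hc.gaussMap_eq _ hw.2.2.1]
    exact dir_angle θ (by simpa using hw.1)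
  · exact fun w hw => ⟨_, hX w hw.2, EventuallyEq.rfl⟩

end IsGraphChart

end LocalChart

end PlanarConvex

theorem mainTheorem4 (K : ConvexBody ℂ) (z : ℂ) (θ : ℝ) (k : ℕ) (hk : 2 ≤ k)
    (hz : z ∈ PlanarConvex.regExp (K : Set ℂ))
    (hθ : θ ∈ PlanarConvex.regularAngles (K : Set ℂ))
    (hzθ : z = PlanarConvex.reverseGaussMap (K : Set ℂ) (Complex.exp (θ * Complex.I))) :
    (PlanarConvex.IsSubmanifoldAt k (PlanarConvex.regExp (K : Set ℂ)) z ∧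
        PlanarConvex.IsDiffeoAt (k - 1) (PlanarConvex.gaussMap (K : Set ℂ))
          (PlanarConvex.regExp (K : Set ℂ)) (Metric.sphere (0 : ℂ) 1) z) ↔
      (ContDiffAt ℝ k (PlanarConvex.supportAngle (K : Set ℂ)) θ ∧
        ∃ ρ : ℝ≥0∞, PlanarConvex.HasRadiusOfCurvature (K : Set ℂ) z ρ ∧ 0 < ρ ∧ ρ < ∞) := by
  obtain ⟨m, rfl⟩ : ∃ m, k = m + 1 := ⟨k - 1, by omega⟩
  have hm : m ≠ 0 := by omega
  have hm' : (m : WithTop ℕ∞) ≠ 0 := by exact_mod_cast hm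
  rw [Nat.add_sub_cancel]
  have hu := PlanarConvex.gaussMap_eq_dir hθ hzθ
  constructor
  · rintro ⟨-, hD⟩
    obtain ⟨X, hXz, hX, hface, hX'⟩ := PlanarConvex.exists_supportCurve_of_isDiffeoAt hm hz hu hD
    obtain ⟨r, hr, hlim⟩ := PlanarConvex.tendsto_boundaryGraph hm hu hXz hX hface hX'
    exact ⟨PlanarConvex.contDiffAt_supportAngle hm hX hface,
      PlanarConvex.exists_hasRadiusOfCurvature hr hlim⟩
  · rintro ⟨hh, ρ, ⟨-, hρ⟩, hρ0, -⟩
    obtain ⟨X, hX, hface⟩ :=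
      PlanarConvex.exists_supportCurve_of_contDiffAt K.isCompact K.nonempty hh
    have hmem : ∀ᶠ t in 𝓝 θ, X t ∈ PlanarConvex.exposedFace (K : Set ℂ) (PlanarConvex.dir t) :=
      hface.mono fun t ht => ht ▸ rfl
    have hXz : X θ = z := by
      have h := PlanarConvex.exposedFace_gaussMap hz
      rw [hu, hface.self_of_nhds] at h
      exact Set.singleton_injective h
    have hU : PlanarConvex.upperCurvature (K : Set ℂ) z < ∞ := by
      rwa [hρ, ENNReal.inv_pos, ← lt_top_iff_ne_top] at hρ0
    obtain ⟨C, hC, hle⟩ := PlanarConvex.exists_boundaryGraph_le hU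
    have hgraph := PlanarConvex.eventually_ofCoords_boundaryGraph_mem K.isCompact K.convex hz.1 hu
    have hr := PlanarConvex.tau_deriv_pos K.isCompact
      (PlanarConvex.eventually_hasDerivAt_supportAngle hm hX hmem)
      (hX.differentiableAt hm').hasDerivAt hmem.self_of_nhds hC (by
        rw [hXz]; exact hgraph.and hle)
    obtain ⟨e, U, hc⟩ := PlanarConvex.exists_isGraphChart hm hz.1 hu hXz hX hface hr.ne'
    exact ⟨hc.isSubmanifoldAt hm, hc.isDiffeoAt hm⟩
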